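/- All graphs are finite and simple. A signed graph $\Gamma=(G,\sigma)$ is a graph $G$ with a sign function $\sigma:E(G)\to\{-1,1\}$. A cycle is negative if it has an odd number of negative edges, and positive otherwise; $\Gamma$ is balanced if all its cycles are positive, and unbalanced otherwise. The index $\lambda_1(\Gamma)$ is the largest eigenvalue of the adjacency matrix of $\Gamma$, whose $(u,v)$ entry is $\sigma(uv)$ if $u$ and $v$ are adjacent and $0$ otherwise. For $U\subseteq V(G)$, switching with respect to $U$ changes the sign of every edge between $U$ and $V(G)\setminus U$. Two signed graphs are switching equivalent if finitely many such operations turn one into the other, where signed graphs are taken up to isomorphism. For $n\ge 5$ let $\Gamma_1$ be the signed graph of order $n$ that consists of a complete graph $K_{n-2}$ and two further vertices $v_1,v_2$ which are joined to each other by a negative edge and are both joined by positive edges to one and the same vertex $v_3$ of $K_{n-2}$; all edges of $K_{n-2}$ are positive, and there are no other edges. Theorem. Let $n\ge 5$ and let $\Gamma$ be an unbalanced signed graph of order $n$. If $\lambda_1(\Gamma)\ge\lambda_1(\Gamma_1)$, then $\Gamma$ contains a negative cycle of length $4$, unless $\Gamma$ is switching equivalent to $\Gamma_1$. Moreover, $\Gamma_1$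 is unbalanced and contains no negative cycle of length $4$, and it is, up to switching equivalence, the unique maximizer of the index among such signed graphs of order $n$: every unbalanced signed graph $\Gamma$ of order $n$ without negative cycles of length $4$ satisfies $\lambda_1(\Gamma)\le\lambda_1(\Gamma_1)$, with equality if and only if $\Gamma$ is switching equivalent to $\Gamma_1$. -/

import Mathlib

/-- A signed graph on the vertex set `V`: a simple underlying graph together with a sign `±1`
for each of its edges. -/
structure SignedGraph (V : Type*) where
  /-- the underlying graph -/
  graph : SimpleGraph V
  /-- the sign function, defined on the edges only -/
  sign : graph.edgeSet → ℤˣ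

namespace SignedGraph

/-- `e` is a negative edge of `Γ`. -/
def IsNegEdge {V : Type*} (Γ : SignedGraph V) (e : Sym2 V) : Prop :=
  ∃ h : e ∈ Γ.graph.edgeSet, Γ.sign ⟨e, h⟩ = -1

open Classical in
/-- The number of negative edges traversed by a walk. -/
noncomputable def negCount {V : Type*} (Γ : SignedGraph V) {u v : V} (w : Γ.graph.Walk u v) : ℕ :=
  w.edges.countP (fun e => decide (Γ.IsNegEdge e))

/-- `Γ` is balanced if each of its cycles has an even number of negative edges. -/
def IsBalanced {V : Type*} (Γ : SignedGraph V) : Prop :=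
  ∀ (u : V) (w : Γ.graph.Walk u u), w.IsCycle → Even (Γ.negCount w)

/-- `Γ` contains a negative cycle of length `k`, i.e. one with an odd number of negative edges. -/
def HasNegCycle {V : Type*} (Γ : SignedGraph V) (k : ℕ) : Prop :=
  ∃ (u : V) (w : Γ.graph.Walk u u), w.IsCycle ∧ w.length = k ∧ Odd (Γ.negCount w)

open Classical in
/-- The adjacency matrix of `Γ`: the entry at `i, j` is the sign of the edge `ij`, and `0` if
`i` and `j` are not adjacent. -/
noncomputable def adjMatrix {V : Type*} (Γ : SignedGraph V) : Matrix V V ℝ :=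
  Matrix.of fun i j =>
    if h : s(i, j) ∈ Γ.graph.edgeSet then ((Γ.sign ⟨s(i, j), h⟩ : ℤ) : ℝ) else 0

open Classical in
/-- The index of `Γ`: the largest (real) eigenvalue of its adjacency matrix. -/
noncomputable def index {V : Type*} [Fintype V] (Γ : SignedGraph V) : ℝ :=
  sSup {μ : ℝ | Module.End.HasEigenvalue (Matrix.toLin' Γ.adjMatrix) μ}

theorem adjMatrix_isHermitian {V : Type*} (Γ : SignedGraph V) : Γ.adjMatrix.IsHermitian := by
  ext i j
  classical
  have key : ∀ e e' : Sym2 V, e = e' → ∀ [Decidable (e ∈ Γ.graph.edgeSet)]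
      [Decidable (e' ∈ Γ.graph.edgeSet)],
      (if h : e ∈ Γ.graph.edgeSet then ((Γ.sign ⟨e, h⟩ : ℤ) : ℝ) else 0)
        = if h : e' ∈ Γ.graph.edgeSet then ((Γ.sign ⟨e', h⟩ : ℤ) : ℝ) else 0 := by
    intro e e' h _ _
    subst h
    congr
  simp only [Matrix.conjTranspose_apply, adjMatrix, Matrix.of_apply, star_trivial]
  convert key s(j, i) s(i, j) Sym2.eq_swap

/-- On a nonempty vertex set the supremum in `index` is attained, so that `index` is indeed the
largest eigenvalue. -/
theorem index_isGreatest {V : Type*} [Fintype V] [Nonempty V] [DecidableEq V]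
    (Γ : SignedGraph V) :
    IsGreatest {μ : ℝ | Module.End.HasEigenvalue (Matrix.toLin' Γ.adjMatrix) μ} Γ.index := by
  classical
  have hS : {μ : ℝ | Module.End.HasEigenvalue (Matrix.toLin' Γ.adjMatrix) μ}
      = Set.range Γ.adjMatrix_isHermitian.eigenvalues := by
    rw [← Γ.adjMatrix_isHermitian.spectrum_real_eq_range_eigenvalues,
      ← Matrix.spectrum_toLin']
    ext μ
    exact Module.End.hasEigenvalue_iff_mem_spectrum
  have hI : Γ.index = sSup {μ : ℝ | Module.End.HasEigenvalue (Matrix.toLin' Γ.adjMatrix) μ} := by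
    unfold index
    congr!
  rw [hI, hS]
  have hf := Set.finite_range Γ.adjMatrix_isHermitian.eigenvalues
  exact ⟨(Set.range_nonempty _).csSup_mem hf, fun x hx => le_csSup hf.bddAbove hx⟩

/-- The edge `e` joins a vertex of `U` to a vertex outside `U`. -/
def Crosses {V : Type*} (U : Set V) (e : Sym2 V) : Prop :=
  ∃ u ∈ U, ∃ v ∉ U, e = s(u, v)

open Classical in
/-- Switching with respect to `U`: the signs of the edges between `U` and its complement change. -/
noncomputable def switch {V : Type*} (Γ : SignedGraph V) (U : Set V) : SignedGraph V where
  graph := Γ.graph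
  sign e := if Crosses U (e : Sym2 V) then -Γ.sign e else Γ.sign e

/-- `Γ` and `Γ'`, on the same vertex set, are switching equivalent: `Γ'` is obtained from `Γ` by
finitely many switching operations. -/
def SwitchingEquivalent {V : Type*} : SignedGraph V → SignedGraph V → Prop :=
  Relation.ReflTransGen (fun Γ Γ' => ∃ U : Set V, Γ' = Γ.switch U)

/-- `Γ` and `Δ` are isomorphic signed graphs: some isomorphism of the underlying graphs preserves
the signs of the edges. -/
def Isomorphic {V W : Type*} (Γ : SignedGraph V) (Δ : SignedGraph W) : Prop :=
  ∃ f : Γ.graph ≃g Δ.graph, ∀ (u v : V) (h : s(u, v) ∈ Γ.graph.edgeSet)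
    (h' : s(f u, f v) ∈ Δ.graph.edgeSet), Δ.sign ⟨s(f u, f v), h'⟩ = Γ.sign ⟨s(u, v), h⟩

/-- Switching equivalence for signed graphs taken up to isomorphism: `Γ` is switching equivalent
to an isomorphic copy of `Δ`. -/
def SwitchingIsomorphic {V W : Type*} (Γ : SignedGraph V) (Δ : SignedGraph W) : Prop :=
  ∃ Γ' : SignedGraph V, SwitchingEquivalent Γ Γ' ∧ Isomorphic Γ' Δ

open Classical in
/-- The signed graph `Γ₁` of order `n`. The vertices `0` and `1` play the role of `v₁` and `v₂`,
the vertex `2` that of their common neighbour; the vertices `2, …, n - 1` form the clique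
`K_{n-2}`, the vertices `0, 1, 2` form a triangle, and there are no further edges. The only
negative edge is the one that joins `0` and `1`. -/
noncomputable def gammaOne (n : ℕ) : SignedGraph (Fin n) where
  graph :=
    { Adj := fun i j => i ≠ j ∧ ((2 ≤ i.val ∧ 2 ≤ j.val) ∨ (i.val ≤ 2 ∧ j.val ≤ 2))
      symm := ⟨fun _ _ h => ⟨h.1.symm, h.2.imp And.symm And.symm⟩⟩
      loopless := ⟨fun _ h => h.1 rfl⟩ }
  sign e := if ∀ i ∈ (e : Sym2 (Fin n)), i.val ≤ 1 then -1 else 1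

end SignedGraph

/-! Switching changes neither the index nor the signs of cycles. Switching at the negative
coordinates of an eigenvector of the index turns it into a vector x ≥ 0. Any weight y ≥ 0 with yA ≤
κy then tests the eigenvalue μ: μ(y·x) = yAx ≤ κ(y·x), so μ > κ forces x and y to have disjoint
supports.

Let t > n - 3 be the root of the cubic belonging to the positive eigenvector of Γ₁, and let μ ≥ t.
The weight y = 1 yields a vertex w whose column sum exceeds n - 3, so w has a positive edge to all
other vertices but at most one. Unbalancedness then yields a negative edge uv whose two ends both
have positive neighbours (`exists_neg_edge`). Without negative 4-cycles, a positive neighbour of u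
and one of v are never joined positively (`nonpos_of_neighbors`). Hence w is a positive neighbour of
both u and v, and every further positive neighbour of u or v is the one exceptional vertex w' of w.

If w' is a positive neighbour of u or v, explicit weights give μ < t. Otherwise A is bounded
entrywise by the matrix of Γ₁, whose positive eigenvector for t serves as the weight. This gives μ =
t, and equality propagates from the support of x to all entries of A. -/

/-! ### Test weights against nonnegative eigenvectors -/

/-- If `y ≥ 0` satisfies `yA ≤ κ y` and `x ≥ 0` is an eigenvector of `A` for an eigenvalue above
`κ`, then `x` and `y` have disjoint supports. -/
theorem mul_eq_zero_of_subinvariant {V : Type*} [Fintype V] {A : V → V → ℝ} {x y : V → ℝ}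
    {κ μ : ℝ} (hx : ∀ i, 0 ≤ x i) (hy : ∀ i, 0 ≤ y i) (hA : ∀ i, ∑ j, A i j * x j = μ * x i)
    (hsub : ∀ j, ∑ i, y i * A i j ≤ κ * y j) (hlt : κ < μ) (i : V) : y i * x i = 0 := by
  have h1 : μ * ∑ i, y i * x i = ∑ j, (∑ i, y i * A i j) * x j := by
    simp_rw [Finset.mul_sum, Finset.sum_mul]
    rw [Finset.sum_comm]
    refine Finset.sum_congr rfl fun i _ => ?_
    rw [show μ * (y i * x i) = y i * (μ * x i) by ring, ← hA i, Finset.mul_sum]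
    exact Finset.sum_congr rfl fun j _ => by ring
  have h2 : ∑ j, (∑ i, y i * A i j) * x j ≤ κ * ∑ i, y i * x i := by
    rw [Finset.mul_sum]
    refine Finset.sum_le_sum fun j _ => ?_
    nlinarith [mul_le_mul_of_nonneg_right (hsub j) (hx j)]
  have h0 : ∀ i ∈ Finset.univ, 0 ≤ y i * x i := fun i _ => mul_nonneg (hy i) (hx i)
  have h3 : ∑ i, y i * x i = 0 := by
    have := Finset.sum_nonneg h0
    nlinarith
  exact (Finset.sum_eq_zero_iff_of_nonneg h0).1 h3 i (Finset.mem_univ i)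

/-- If `yA ≤ μ y` and `x ≥ 0` is an eigenvector of `A` for `μ`, then equality
holds at every coordinate in the support of `x`. -/
theorem sum_eq_of_subinvariant {V : Type*} [Fintype V] {A : V → V → ℝ} {x y : V → ℝ}
    {μ : ℝ} (hx : ∀ i, 0 ≤ x i) (hA : ∀ i, ∑ j, A i j * x j = μ * x i)
    (hsub : ∀ j, ∑ i, y i * A i j ≤ μ * y j) (j : V) (hj : x j ≠ 0) :
    ∑ i, y i * A i j = μ * y j := by
  have h1 : ∑ j, (μ * y j - ∑ i, y i * A i j) * x j = 0 := by
    simp_rw [sub_mul, Finset.sum_sub_distrib, Finset.sum_mul]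
    rw [Finset.sum_comm, sub_eq_zero]
    refine Finset.sum_congr rfl fun i _ => ?_
    rw [show μ * y i * x i = y i * (μ * x i) by ring, ← hA i, Finset.mul_sum]
    exact Finset.sum_congr rfl fun j _ => by ring
  have h2 := (Finset.sum_eq_zero_iff_of_nonneg
    (fun j _ => mul_nonneg (sub_nonneg.2 (hsub j)) (hx j))).1 h1 j (Finset.mem_univ j)
  rcases mul_eq_zero.1 h2 with h | h
  · linarith
  · exact absurd h hj

/-- The other `card V - 3` terms are at most 1 each. Applied to a column of the matrix, the zero on
the diagonal and two nonpositive entries already suffice. -/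
theorem sum_le_card_sub_three {V : Type*} [Fintype V] {f : V → ℝ} {a b c : V}
    (hab : a ≠ b) (hac : a ≠ c) (hbc : b ≠ c) (hf : ∀ i, f i ≤ 1) (h : f a + f b + f c ≤ 0) :
    ∑ i, f i ≤ (Fintype.card V : ℝ) - 3 := by
  classical
  have h1 : ∑ i, f i = (∑ i ∈ {a, b, c}, f i) + ∑ i ∈ ({a, b, c} : Finset V)ᶜ, f i :=
    (Finset.sum_add_sum_compl _ _).symm
  have h2 : ∑ i ∈ ({a, b, c} : Finset V)ᶜ, f i ≤ (({a, b, c} : Finset V)ᶜ.card : ℝ) := by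
    simpa using Finset.sum_le_card_nsmul ({a, b, c} : Finset V)ᶜ f 1 fun i _ => hf i
  have h3 : ({a, b, c} : Finset V).card = 3 := by
    rw [Finset.card_eq_three]; exact ⟨a, b, c, hab, hac, hbc, rfl⟩
  have h4 : (({a, b, c} : Finset V)ᶜ.card : ℝ) = (Fintype.card V : ℝ) - 3 := by
    have := Finset.card_add_card_compl ({a, b, c} : Finset V)
    rw [h3] at this
    rw [← this]; push_cast; ring
  have h5 : ∑ i ∈ {a, b, c}, f i = f a + f b + f c := by
    rw [Finset.sum_insert (by simp [hab, hac]), Finset.sum_pair hbc]; ring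
  linarith

/-! ### The matrix of Γ₁ and its positive eigenvector -/

/-- The adjacency matrix of a complete graph with a pendant triangle, glued at the vertex `w`,
whose edge `uv` opposite to `w` is negative. -/
noncomputable def pendantTriangleMatrix {V : Type*} [DecidableEq V] (u v w : V) (i j : V) : ℝ :=
  if i = j then 0
  else if (i = u ∨ i = v) ∧ (j = u ∨ j = v) then -1
  else if i = w ∨ j = w then 1
  else if i = u ∨ i = v ∨ j = u ∨ j = v then 0 else 1

/-- The positive eigenvector of `pendantTriangleMatrix u v w` for `t`. -/
noncomputable def pendantTriangleVec {V : Type*} [Fintype V] [DecidableEq V] (u v w : V) (t : ℝ)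
    (i : V) : ℝ :=
  if i = u ∨ i = v then (t + 1)⁻¹ else if i = w then 1 else (t - Fintype.card V + 4)⁻¹

/-- An eigenvector with value 1 at w has value 1/(t+1) at u and v and 1/(t-n+4) on the remaining n -
3 vertices. The cubic is the equation at w, t = 2/(t+1) + (n-3)/(t-n+4), with denominators cleared.
-/
theorem exists_pendantTriangle_root (n : ℕ) (hn : 5 ≤ n) :
    ∃ t : ℝ, (n : ℝ) - 3 < t ∧
      t * (t + 1) * (t - n + 4) = 2 * (t - n + 4) + (n - 3) * (t + 1) := by
  have hn' : (5 : ℝ) ≤ n := by exact_mod_cast hn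
  let f : ℝ → ℝ := fun t => t * (t + 1) * (t - n + 4) - (2 * (t - n + 4) + (n - 3) * (t + 1))
  have hf : ContinuousOn f (Set.Icc ((n : ℝ) - 3) n) := by fun_prop
  -- The negative value at n - 3 makes the root strictly larger than n - 3, the bound against which
  -- all other cases are compared.
  have h0 : f ((n : ℝ) - 3) = -2 := by simp only [f]; ring
  have h1 : 0 ≤ f n := by simp only [f]; nlinarith
  obtain ⟨t, ht, hft⟩ := intermediate_value_Icc (by linarith) hf
    (show (0 : ℝ) ∈ Set.Icc _ _ from ⟨by rw [h0]; norm_num, h1⟩)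
  refine ⟨t, lt_of_le_of_ne ht.1 ?_, by simp only [f] at hft; linarith⟩
  rintro rfl
  rw [h0] at hft
  norm_num at hft

theorem sum_eq_add_three {V : Type*} [Fintype V] [DecidableEq V] {u v w : V} (huv : u ≠ v)
    (huw : u ≠ w) (hvw : v ≠ w) (f : V → ℝ) :
    ∑ i, f i = f u + f v + f w + ∑ i ∈ ({u, v, w} : Finset V)ᶜ, f i := by
  rw [← Finset.sum_add_sum_compl {u, v, w} f, Finset.sum_insert (by simp [huv, huw]),
    Finset.sum_pair hvw]
  ring

theorem card_compl_triple {V : Type*} [Fintype V] [DecidableEq V] {u v w : V} (huv : u ≠ v)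
    (huw : u ≠ w) (hvw : v ≠ w) :
    ((({u, v, w} : Finset V)ᶜ).card : ℝ) = (Fintype.card V : ℝ) - 3 := by
  have h3 : ({u, v, w} : Finset V).card = 3 := by
    rw [Finset.card_eq_three]; exact ⟨u, v, w, huv, huw, hvw, rfl⟩
  have := Finset.card_add_card_compl ({u, v, w} : Finset V)
  rw [h3] at this
  rw [← this]; push_cast; ring

theorem sum_pendantTriangle {V : Type*} [Fintype V] [DecidableEq V] {u v w : V} (huv : u ≠ v)
    (huw : u ≠ w) (hvw : v ≠ w) {t : ℝ} (hcard : 5 ≤ Fintype.card V)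
    (ht : (Fintype.card V : ℝ) - 3 < t)
    (hroot : t * (t + 1) * (t - Fintype.card V + 4) =
      2 * (t - Fintype.card V + 4) + (Fintype.card V - 3) * (t + 1)) (j : V) :
    ∑ i, pendantTriangleVec u v w t i * pendantTriangleMatrix u v w i j =
      t * pendantTriangleVec u v w t j := by
  have hn' : (5 : ℝ) ≤ Fintype.card V := by exact_mod_cast hcard
  have ht1 : t + 1 ≠ 0 := by linarith
  have ht2 : t - Fintype.card V + 4 ≠ 0 := by linarith
  rw [sum_eq_add_three huv huw hvw]
  have hR : ∀ i ∈ ({u, v, w} : Finset V)ᶜ, i ≠ u ∧ i ≠ v ∧ i ≠ w := by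
    intro i hi; simpa using hi
  have hc := card_compl_triple huv huw hvw
  by_cases hju : j = u
  · subst hju
    rw [Finset.sum_eq_zero fun i hi => by
      obtain ⟨h1, h2, h3⟩ := hR i hi
      simp [pendantTriangleMatrix, h1, h2, h3, huw]]
    simp only [pendantTriangleVec, pendantTriangleMatrix, huv, huw, hvw, huv.symm, huw.symm,
      hvw.symm, if_true, if_false, or_true, or_false, and_true]
    field_simp
    ring
  by_cases hjv : j = v
  · subst hjv
    rw [Finset.sum_eq_zero fun i hi => by
      obtain ⟨h1, h2, h3⟩ := hR i hi
      simp [pendantTriangleMatrix, h1, h2, h3, hvw]]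
    simp only [pendantTriangleVec, pendantTriangleMatrix, huv, huw, hvw, huv.symm, huw.symm,
      hvw.symm, if_true, if_false, or_true, or_false, and_true]
    field_simp
    ring
  by_cases hjw : j = w
  · subst hjw
    rw [Finset.sum_congr rfl fun i hi => by
      obtain ⟨h1, h2, h3⟩ := hR i hi
      rw [show pendantTriangleVec u v j t i * pendantTriangleMatrix u v j i j =
        (t - Fintype.card V + 4)⁻¹ by
          simp [pendantTriangleVec, pendantTriangleMatrix, h1, h2, h3, hju, hjv]]]
    rw [Finset.sum_const, nsmul_eq_mul, hc]
    simp only [pendantTriangleVec, pendantTriangleMatrix, huv, huw, hvw, huv.symm, huw.symm,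
      hvw.symm, if_true, if_false, true_or, or_true, or_self, and_false]
    field_simp
    linarith
  · have hj : j ∈ ({u, v, w} : Finset V)ᶜ := by simp [hju, hjv, hjw]
    rw [← Finset.add_sum_erase _ _ hj]
    rw [Finset.sum_congr rfl fun i hi => by
      obtain ⟨h1, h2, h3⟩ := hR i (Finset.mem_of_mem_erase hi)
      rw [show pendantTriangleVec u v w t i * pendantTriangleMatrix u v w i j =
        (t - Fintype.card V + 4)⁻¹ by
          simp [pendantTriangleVec, pendantTriangleMatrix, h1, h2, h3, hju, hjv, hjw,
            Finset.ne_of_mem_erase hi]]]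
    rw [Finset.sum_const, nsmul_eq_mul, Finset.card_erase_of_mem hj,
      Nat.cast_sub (Finset.card_pos.2 ⟨j, hj⟩), hc]
    simp only [pendantTriangleVec, pendantTriangleMatrix, huv, huw, hvw, huv.symm, huw.symm,
      hvw.symm, hju, hjv, hjw, Ne.symm hju, Ne.symm hjv, Ne.symm hjw, if_true, if_false, true_or,
      or_true, or_self, and_false]
    field_simp
    push_cast
    ring

/-! ### Positive neighbours along a negative edge -/

/-- The adjacency matrix of an unbalanced signed graph without negative `4`-cycles. -/
structure IsUnbalancedC4Free {V : Type*} (A : V → V → ℝ) : Prop where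
  entry : ∀ i j, A i j = -1 ∨ A i j = 0 ∨ A i j = 1
  symm : ∀ i j, A i j = A j i
  diag : ∀ i, A i i = 0
  four_cycle : ∀ a b c d, a ≠ c → b ≠ d → 0 ≤ A a b * A b c * A c d * A d a
  unbalanced : ∀ ε : V → ℝ, (∀ i, ε i = 1 ∨ ε i = -1) → ∃ i j, ε i * A i j * ε j < 0

namespace IsUnbalancedC4Free

variable {V : Type*} {A : V → V → ℝ}

theorem le_one (h : IsUnbalancedC4Free A) (i j : V) : A i j ≤ 1 := by
  rcases h.entry i j with h | h | h <;> rw [h] <;> norm_num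

theorem nonpos_of_ne_one (h : IsUnbalancedC4Free A) {i j : V} (hij : A i j ≠ 1) : A i j ≤ 0 := by
  rcases h.entry i j with h | h | h
  · rw [h]; norm_num
  · rw [h]
  · exact absurd h hij

/-- Either all row sums are small, or some negative edge has a positive edge at both ends. -/
theorem exists_neg_edge [Fintype V] (h : IsUnbalancedC4Free A) (hcard : 3 ≤ Fintype.card V) :
    (∀ j, ∑ i, A i j ≤ (Fintype.card V : ℝ) - 3) ∨
      ∃ u v a b, A u v = -1 ∧ A u a = 1 ∧ A v b = 1 := by
  classical
  have hcard' : (3 : ℝ) ≤ Fintype.card V := by exact_mod_cast hcard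
  -- Two vertices without positive edges make every column sum small. If there is at most one such
  -- vertex, switching at it must leave a negative edge, and that edge joins two vertices with
  -- positive edges.
  by_cases hI : ∃ i j, i ≠ j ∧ (∀ a, A i a ≠ 1) ∧ ∀ a, A j a ≠ 1
  · obtain ⟨i, i', hne, hi, hi'⟩ := hI
    left
    intro j
    by_cases hj : ∀ a, A j a ≠ 1
    · have : ∑ i, A i j ≤ 0 :=
        Finset.sum_nonpos fun k _ => by rw [h.symm]; exact h.nonpos_of_ne_one (hj k)
      linarith
    · have hji : j ≠ i := by rintro rfl; exact hj hi
      have hji' : j ≠ i' := by rintro rfl; exact hj hi'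
      refine sum_le_card_sub_three hji hji' hne (fun k => h.le_one k j) ?_
      have h1 := h.nonpos_of_ne_one (hi j)
      have h2 := h.nonpos_of_ne_one (hi' j)
      have h3 := h.diag j
      linarith
  · right
    by_contra hno
    push Not at hI hno
    obtain ⟨i, j, hij⟩ := h.unbalanced (fun i => if ∀ a, A i a ≠ 1 then -1 else 1)
      (fun i => by split_ifs <;> simp)
    by_cases hi : ∀ a, A i a ≠ 1 <;> by_cases hj : ∀ a, A j a ≠ 1
    · by_cases hne : i = j
      · subst hne
        rw [h.diag] at hij
        simp at hij
      · obtain ⟨a, ha⟩ := hI i j hne hi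
        exact hj a ha
    · rw [if_pos hi, if_neg hj] at hij
      have := h.nonpos_of_ne_one (hi j)
      linarith
    · rw [if_neg hi, if_pos hj] at hij
      have := h.nonpos_of_ne_one (hj i)
      rw [h.symm] at this
      linarith
    · rw [if_neg hi, if_neg hj] at hij
      push Not at hi hj
      obtain ⟨a, ha⟩ := hi
      obtain ⟨b, hb⟩ := hj
      refine hno i j a b ?_ ha hb
      rcases h.entry i j with h | h | h
      · exact h
      · rw [h] at hij; norm_num at hij
      · rw [h] at hij; norm_num at hij

/-- Positive neighbours of the two ends of a negative edge are not joined by a positive edge. -/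
theorem nonpos_of_neighbors (h : IsUnbalancedC4Free A) {u v a b : V} (huv : A u v = -1)
    (ha : A u a = 1) (hb : A v b = 1) : A a b ≤ 0 := by
  refine h.nonpos_of_ne_one fun hab => ?_
  have hav : a ≠ v := by rintro rfl; rw [huv] at ha; norm_num at ha
  have hbu : b ≠ u := by rintro rfl; rw [h.symm, huv] at hb; norm_num at hb
  have := h.four_cycle u a b v hbu.symm hav
  rw [ha, hab, h.symm b v, hb, h.symm v u, huv] at this
  norm_num at this

/-! ### Spectral bounds by the positive neighbours of u and v -/

variable [Fintype V]

/-- Entrywise domination by the matrix of Γ₁ makes its positive eigenvector a test weight for A,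
whence μ ≤ t. At μ = t no entry in a column j with `x j ≠ 0` can be smaller, and x vanishes at most
at u and v. -/
theorem eq_pendantTriangleMatrix [DecidableEq V] (h : IsUnbalancedC4Free A)
    (hcard : 5 ≤ Fintype.card V)
    {u v w : V} (hvw : v ≠ w) (huw : u ≠ w) (huv : A u v = -1) (hu : ∀ z, A u z = 1 → z = w)
    (hv : ∀ z, A v z = 1 → z = w) {x : V → ℝ} {μ t : ℝ} (hx : ∀ i, 0 ≤ x i) (hx0 : x ≠ 0)
    (hA : ∀ i, ∑ j, A i j * x j = μ * x i) (ht : (Fintype.card V : ℝ) - 3 < t)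
    (hroot : t * (t + 1) * (t - Fintype.card V + 4) =
      2 * (t - Fintype.card V + 4) + (Fintype.card V - 3) * (t + 1)) (hμ : t ≤ μ) :
    μ = t ∧ ∀ i j, A i j = pendantTriangleMatrix u v w i j := by
  have hne : u ≠ v := by rintro rfl; rw [h.diag] at huv; norm_num at huv
  have hcard' : (5 : ℝ) ≤ Fintype.card V := by exact_mod_cast hcard
  have hy : ∀ i, 0 < pendantTriangleVec u v w t i := by
    intro i
    unfold pendantTriangleVec
    split_ifs
    · exact inv_pos.2 (by linarith)
    · exact one_pos
    · exact inv_pos.2 (by linarith)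
  have hvu : A v u = -1 := by rw [h.symm, huv]
  have hAM : ∀ i j, A i j ≤ pendantTriangleMatrix u v w i j := by
    intro i j
    unfold pendantTriangleMatrix
    split_ifs with h1 h2 h3 h4
    · rw [h1, h.diag]
    · rcases h2 with ⟨rfl | rfl, rfl | rfl⟩
      · exact absurd rfl h1
      · exact huv.le
      · exact hvu.le
      · exact absurd rfl h1
    · exact h.le_one _ _
    · push Not at h3
      refine h.nonpos_of_ne_one fun hij => ?_
      have hji := hij
      rw [h.symm] at hji
      rcases h4 with rfl | rfl | rfl | rfl
      · exact h3.2 (hu _ hij)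
      · exact h3.2 (hv _ hij)
      · exact h3.1 (hu _ hji)
      · exact h3.1 (hv _ hji)
    · exact h.le_one _ _
  have hsum := sum_pendantTriangle hne huw hvw hcard ht hroot
  have hsub : ∀ j, ∑ i, pendantTriangleVec u v w t i * A i j ≤
      t * pendantTriangleVec u v w t j := by
    intro j
    rw [← hsum j]
    exact Finset.sum_le_sum fun i _ => mul_le_mul_of_nonneg_left (hAM i j) (hy i).le
  have hμt : μ = t := by
    refine le_antisymm (not_lt.1 fun hlt => hx0 ?_) hμ
    funext i
    have := mul_eq_zero_of_subinvariant hx (fun i => (hy i).le) hA hsub hlt i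
    exact (mul_eq_zero.1 this).resolve_left (hy i).ne'
  subst hμt
  refine ⟨rfl, ?_⟩
  have hcol : ∀ j, x j ≠ 0 → ∀ i, A i j = pendantTriangleMatrix u v w i j := by
    intro j hj i
    have h1 := sum_eq_of_subinvariant hx hA hsub j hj
    rw [← hsum j] at h1
    have h2 := (Finset.sum_eq_sum_iff_of_le
      fun i _ => mul_le_mul_of_nonneg_left (hAM i j) (hy i).le).1 h1 i (Finset.mem_univ i)
    exact mul_left_cancel₀ (hy i).ne' h2
  -- If x vanishes at i, the eigenvalue equation there is a vanishing sum of nonnegative terms, so x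
  -- vanishes at all positive neighbours of i in Γ₁. Through w, a zero outside u and v would spread
  -- to every vertex.
  have hrow : ∀ i, x i = 0 → (∀ j, 0 ≤ pendantTriangleMatrix u v w i j) →
      ∀ j, pendantTriangleMatrix u v w i j = 1 → x j = 0 := by
    intro i hi hM j hj
    by_contra hxj
    have h1 := hA i
    rw [hi, mul_zero] at h1
    have h2 : ∀ k ∈ Finset.univ, 0 ≤ A i k * x k := by
      intro k _
      by_cases hk : x k = 0
      · simp [hk]
      · rw [hcol k hk]
        exact mul_nonneg (hM k) (hx k)
    have h3 := (Finset.sum_eq_zero_iff_of_nonneg h2).1 h1 j (Finset.mem_univ j)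
    rw [hcol j hxj, hj, one_mul] at h3
    exact hxj h3
  have hxw : x w ≠ 0 := by
    intro hw
    refine hx0 (funext fun j => ?_)
    by_cases hj : j = w
    · rw [hj]; exact hw
    · refine hrow w hw (fun k => ?_) j ?_
      · unfold pendantTriangleMatrix
        simp only [huw.symm, hvw.symm, false_or, false_and, if_false, true_or, if_true]
        split_ifs <;> norm_num
      · unfold pendantTriangleMatrix
        simp [huw.symm, hvw.symm, Ne.symm hj]
  have hxz : ∀ z, z ≠ u → z ≠ v → x z ≠ 0 := by
    intro z hzu hzv
    by_cases hzw : z = w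
    · rw [hzw]; exact hxw
    intro hz
    refine hxw (hrow z hz (fun k => ?_) w ?_)
    · unfold pendantTriangleMatrix
      simp only [hzu, hzv, or_self, false_and, if_false]
      split_ifs <;> norm_num
    · unfold pendantTriangleMatrix
      simp [hzu, hzv, hzw]
  have hMs : ∀ i j, pendantTriangleMatrix u v w i j = pendantTriangleMatrix u v w j i := by
    intro i j
    unfold pendantTriangleMatrix
    congr 1
    · exact propext eq_comm
    · congr 1
      · exact propext and_comm
      · congr 1
        · exact propext or_comm
        · congr 1
          exact propext (by tauto)
  -- Columns other than u and v agree by `hcol`, rows other than u and v by symmetry; the block on u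
  -- and v is given.
  intro i j
  by_cases hj : j ≠ u ∧ j ≠ v
  · exact hcol j (hxz j hj.1 hj.2) i
  by_cases hi : i ≠ u ∧ i ≠ v
  · rw [h.symm, hMs]
    exact hcol i (hxz i hi.1 hi.2) j
  have hj' : j = u ∨ j = v := by tauto
  have hi' : i = u ∨ i = v := by tauto
  unfold pendantTriangleMatrix
  by_cases hij : i = j
  · rw [if_pos hij, hij, h.diag]
  · rw [if_neg hij, if_pos ⟨hi', hj'⟩]
    rcases hi' with rfl | rfl <;> rcases hj' with rfl | rfl
    · exact absurd rfl hij
    · exact huv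
    · exact hvu
    · exact absurd rfl hij

/-- The positive neighbours of `u` are `w` and `w'`, the only positive neighbour of `v` is `w`. -/
theorem eigenvalue_le_of_neighbors_pair_single (h : IsUnbalancedC4Free A)
    (hcard : 5 ≤ Fintype.card V)
    {u v w w' : V} (hww : w ≠ w') (huv : A u v = -1) (huw : A u w = 1) (huw' : A u w' = 1)
    (hvw : A v w = 1) (hu : ∀ z, A u z = 1 → z = w ∨ z = w')
    (hv : ∀ z, A v z = 1 → z = w) {x : V → ℝ} {μ : ℝ} (hx : ∀ i, 0 ≤ x i) (hx0 : x ≠ 0)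
    (hA : ∀ i, ∑ j, A i j * x j = μ * x i) : μ ≤ (Fintype.card V : ℝ) - 3 := by
  classical
  by_contra! hlt
  have hcard' : (5 : ℝ) ≤ Fintype.card V := by exact_mod_cast hcard
  have hne : u ≠ v := by rintro rfl; rw [h.diag] at huv; norm_num at huv
  have hvw_ne : v ≠ w := by rintro rfl; rw [h.diag] at hvw; norm_num at hvw
  have huw_ne : u ≠ w := by rintro rfl; rw [h.diag] at huw; norm_num at huw
  have huw'_ne : u ≠ w' := by rintro rfl; rw [h.diag] at huw'; norm_num at huw'
  have hvw'_ne : v ≠ w' := by rintro rfl; rw [huv] at huw'; norm_num at huw'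
  have hvu : A v u = -1 := by rw [h.symm, huv]
  -- The weight is 0 at v and 1 elsewhere. In column v the entries at u and w cancel. Any other
  -- column j loses v, its diagonal entry, and one more nonpositive entry k.
  have hyA : ∀ j, ∑ i, (if i = v then (0 : ℝ) else 1) * A i j ≤
      ((Fintype.card V : ℝ) - 3) * (if j = v then (0 : ℝ) else 1) := by
    intro j
    by_cases hj : j = v
    · subst hj
      rw [if_pos rfl, mul_zero, sum_eq_add_three hne huw_ne hvw_ne]
      have : ∑ i ∈ ({u, j, w} : Finset V)ᶜ, (if i = j then (0 : ℝ) else 1) * A i j ≤ 0 := by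
        refine Finset.sum_nonpos fun i hi => ?_
        simp only [Finset.mem_compl, Finset.mem_insert, Finset.mem_singleton, not_or] at hi
        rw [if_neg hi.2.1, one_mul, h.symm]
        exact h.nonpos_of_ne_one fun hc => hi.2.2 (hv i hc)
      rw [if_pos rfl, if_neg hne, if_neg hvw_ne.symm, huv, h.symm w j, hvw]
      linarith
    · rw [if_neg hj, mul_one]
      have hk : ∃ k, k ≠ j ∧ k ≠ v ∧ A k j ≤ 0 := by
        by_cases hju : j = u
        -- A fifth vertex is needed here; it is not a positive neighbour of u.
        · obtain ⟨k, hk⟩ : ∃ k, k ∉ ({u, v, w, w'} : Finset V) := by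
            by_contra! hall
            have h1 : Finset.univ ⊆ ({u, v, w, w'} : Finset V) := fun k _ => hall k
            have h2 := Finset.card_le_card h1
            have h3 : ({u, v, w, w'} : Finset V).card ≤ 4 := Finset.card_le_four
            rw [Finset.card_univ] at h2
            omega
          simp only [Finset.mem_insert, Finset.mem_singleton, not_or] at hk
          refine ⟨k, by rw [hju]; exact hk.1, hk.2.1, ?_⟩
          rw [hju, h.symm]
          refine h.nonpos_of_ne_one fun hc => ?_
          rcases hu k hc with hc | hc
          · exact hk.2.2.1 hc
          · exact hk.2.2.2 hc
        by_cases hjw : j = w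
        · refine ⟨w', by rw [hjw]; exact hww.symm, hvw'_ne.symm, ?_⟩
          rw [hjw]
          exact h.nonpos_of_neighbors huv huw' hvw
        by_cases hjw' : j = w'
        · refine ⟨w, by rw [hjw']; exact hww, hvw_ne.symm, ?_⟩
          rw [hjw', h.symm]
          exact h.nonpos_of_neighbors huv huw' hvw
        · refine ⟨u, Ne.symm hju, hne, h.nonpos_of_ne_one fun hc => ?_⟩
          rcases hu j hc with hc | hc
          · exact hjw hc
          · exact hjw' hc
      obtain ⟨k, hkj, hkv, hk⟩ := hk
      refine sum_le_card_sub_three hkj hkv hj (fun i => ?_) ?_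
      · split_ifs
        · norm_num
        · rw [one_mul]; exact h.le_one i j
      · rw [if_neg hkv, if_neg hj, if_pos rfl, h.diag]
        linarith
  have hzero := mul_eq_zero_of_subinvariant hx (fun i => by split_ifs <;> norm_num) hA hyA hlt
  have hxne : ∀ i, i ≠ v → x i = 0 := by
    intro i hi
    have := hzero i
    rwa [if_neg hi, one_mul] at this
  have hxv := hA v
  -- The weight vanishes at v, so x may still live on v alone; the zero diagonal entry then gives μ
  -- x v = 0.
  rw [Finset.sum_eq_zero fun j _ => by
    by_cases hj : j = v
    · rw [hj, h.diag, zero_mul]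
    · rw [hxne j hj, mul_zero]] at hxv
  have hμ : μ ≠ 0 := by linarith
  have hxv0 : x v = 0 := (mul_eq_zero.1 hxv.symm).resolve_left hμ
  refine hx0 (funext fun i => ?_)
  by_cases hi : i = v
  · rw [hi]; exact hxv0
  · exact hxne i hi

/-- The positive neighbours of both `u` and `v` are `w` and `w'`. -/
theorem eigenvalue_le_of_neighbors_pair_pair (h : IsUnbalancedC4Free A)
    {u v w w' : V} (hww : w ≠ w') (huv : A u v = -1) (huw : A u w = 1) (huw' : A u w' = 1)
    (hvw : A v w = 1) (hvw' : A v w' = 1) (hu : ∀ z, A u z = 1 → z = w ∨ z = w')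
    (hv : ∀ z, A v z = 1 → z = w ∨ z = w') {x : V → ℝ} {μ κ p r : ℝ} (hx : ∀ i, 0 ≤ x i)
    (hx0 : x ≠ 0) (hA : ∀ i, ∑ j, A i j * x j = μ * x i) (hp : 0 < p) (hr : 0 < r)
    (h1 : -p + 2 ≤ κ * p) (h2 : 2 * p + r * (Fintype.card V - 4) ≤ κ)
    (h3 : 2 + r * (Fintype.card V - 5) ≤ κ * r) : μ ≤ κ := by
  classical
  by_contra! hlt
  have hne : u ≠ v := by rintro rfl; rw [h.diag] at huv; norm_num at huv
  have hvw_ne : v ≠ w := by rintro rfl; rw [h.diag] at hvw; norm_num at hvw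
  have huw_ne : u ≠ w := by rintro rfl; rw [h.diag] at huw; norm_num at huw
  have huw'_ne : u ≠ w' := by rintro rfl; rw [h.diag] at huw'; norm_num at huw'
  have hvw'_ne : v ≠ w' := by rintro rfl; rw [huv] at huw'; norm_num at huw'
  have hvu : A v u = -1 := by rw [h.symm, huv]
  set R : Finset V := ({u, v, w} : Finset V)ᶜ.erase w' with hRdef
  have hw'R : w' ∈ ({u, v, w} : Finset V)ᶜ := by
    simp [huw'_ne.symm, hvw'_ne.symm, hww.symm]
  have hRcard : (R.card : ℝ) = (Fintype.card V : ℝ) - 4 := by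
    rw [hRdef, Finset.card_erase_of_mem hw'R, Nat.cast_sub (Finset.card_pos.2 ⟨w', hw'R⟩),
      card_compl_triple hne huw_ne hvw_ne]
    push_cast; ring
  have hR : ∀ i, i ∈ R ↔ i ≠ u ∧ i ≠ v ∧ i ≠ w ∧ i ≠ w' := by
    intro i; simp [hRdef]; tauto
  -- The hypotheses `h1`, `h2`, `h3` are the column inequalities for this weight at u and v, at w
  -- and w', and at the remaining vertices.
  let y : V → ℝ := fun i => if i = u ∨ i = v then p else if i = w ∨ i = w' then 1 else r
  have hyu : y u = p := by simp [y]
  have hyv : y v = p := by simp [y]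
  have hyw : y w = 1 := by simp [y, huw_ne.symm, hvw_ne.symm]
  have hyw' : y w' = 1 := by simp [y, huw'_ne.symm, hvw'_ne.symm]
  have hyR : ∀ i ∈ R, y i = r := by
    intro i hi
    obtain ⟨a, b, c, d⟩ := (hR i).1 hi
    simp [y, a, b, c, d]
  have hsum : ∀ j, ∑ i, y i * A i j =
      p * A u j + p * A v j + A w j + A w' j + r * ∑ i ∈ R, A i j := by
    intro j
    rw [sum_eq_add_three hne huw_ne hvw_ne, ← Finset.add_sum_erase _ _ hw'R, ← hRdef,
      hyu, hyv, hyw, hyw', Finset.mul_sum,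
      Finset.sum_congr rfl fun i hi => by rw [hyR i hi]]
    ring
  have hRu : ∀ i ∈ R, A i u ≤ 0 := by
    intro i hi
    obtain ⟨a, b, c, d⟩ := (hR i).1 hi
    rw [h.symm]
    exact h.nonpos_of_ne_one fun hc => (hu i hc).elim c d
  have hRv : ∀ i ∈ R, A i v ≤ 0 := by
    intro i hi
    obtain ⟨a, b, c, d⟩ := (hR i).1 hi
    rw [h.symm]
    exact h.nonpos_of_ne_one fun hc => (hv i hc).elim c d
  have hRle : ∀ j, ∑ i ∈ R, A i j ≤ (Fintype.card V : ℝ) - 4 := by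
    intro j
    rw [← hRcard]
    simpa using Finset.sum_le_card_nsmul R (fun i => A i j) 1 fun i _ => h.le_one i j
  have hw'w : A w' w ≤ 0 := h.nonpos_of_neighbors huv huw' hvw
  have hyA : ∀ j, ∑ i, y i * A i j ≤ κ * y j := by
    intro j
    rw [hsum]
    by_cases hju : j = u
    · have := Finset.sum_nonpos hRu
      rw [hju, hyu, h.diag, hvu, h.symm w, huw, h.symm w', huw']
      nlinarith
    by_cases hjv : j = v
    · have := Finset.sum_nonpos hRv
      rw [hjv, hyv, h.diag, huv, h.symm w, hvw, h.symm w', hvw']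
      nlinarith
    by_cases hjw : j = w
    · have := mul_le_mul_of_nonneg_left (hRle w) hr.le
      rw [hjw, hyw, h.diag, huw, hvw]
      linarith
    by_cases hjw' : j = w'
    · have := mul_le_mul_of_nonneg_left (hRle w') hr.le
      rw [hjw', hyw', h.diag, huw', hvw', h.symm w w']
      linarith
    · have hj : j ∈ R := (hR j).2 ⟨hju, hjv, hjw, hjw'⟩
      have h4 : ∑ i ∈ R, A i j ≤ (Fintype.card V : ℝ) - 5 := by
        rw [← Finset.add_sum_erase _ _ hj, h.diag, zero_add]
        have := Finset.sum_le_card_nsmul (R.erase j) (fun i => A i j) 1 fun i _ => h.le_one i j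
        rw [Finset.card_erase_of_mem hj, nsmul_eq_mul,
          Nat.cast_sub (Finset.card_pos.2 ⟨j, hj⟩), hRcard] at this
        push_cast at this
        linarith
      have h5 := mul_le_mul_of_nonneg_left h4 hr.le
      have h6 := mul_nonpos_of_nonneg_of_nonpos hp.le (hRu j hj)
      have h7 := mul_nonpos_of_nonneg_of_nonpos hp.le (hRv j hj)
      rw [hyR j hj, h.symm u, h.symm v]
      linarith [h.le_one w j, h.le_one w' j]
  have hypos : ∀ i, 0 < y i := by
    intro i
    simp only [y]
    split_ifs <;> first | assumption | norm_num
  refine hx0 (funext fun i => ?_)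
  have := mul_eq_zero_of_subinvariant hx (fun i => (hypos i).le) hA hyA hlt i
  exact (mul_eq_zero.1 this).resolve_left (hypos i).ne'

theorem eigenvalue_le_root_of_neighbors_pair_pair (h : IsUnbalancedC4Free A)
    (hcard : 5 ≤ Fintype.card V)
    {u v w w' : V} (hww : w ≠ w') (huv : A u v = -1) (huw : A u w = 1) (huw' : A u w' = 1)
    (hvw : A v w = 1) (hvw' : A v w' = 1) (hu : ∀ z, A u z = 1 → z = w ∨ z = w')
    (hv : ∀ z, A v z = 1 → z = w ∨ z = w') {x : V → ℝ} {μ t : ℝ} (hx : ∀ i, 0 ≤ x i)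
    (hx0 : x ≠ 0) (hA : ∀ i, ∑ j, A i j * x j = μ * x i)
    (ht : (Fintype.card V : ℝ) - 3 < t)
    (hroot : t * (t + 1) * (t - Fintype.card V + 4) =
      2 * (t - Fintype.card V + 4) + (Fintype.card V - 3) * (t + 1)) : μ < t := by
  rcases hcard.eq_or_lt with h5 | h6
  · have h5' : (Fintype.card V : ℝ) = 5 := by rw [← h5]; norm_num
    rw [h5'] at ht hroot
    -- For n = 5 the cubic becomes t(t² - 5) = 0, so t = √5, and κ = 11/5 is a rational just below
    -- it. The values p = 2/(κ+1) and r = 2/κ turn the first and third inequality into equalities.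
    have : μ ≤ 11 / 5 := h.eigenvalue_le_of_neighbors_pair_pair hww huv huw huw' hvw hvw' hu hv hx
      hx0 hA (p := 5 / 8) (r := 10 / 11) (by norm_num) (by norm_num) (by norm_num)
      (by rw [h5']; norm_num) (by rw [h5']; norm_num)
    have h2 : t * (t ^ 2 - 5) = 0 := by linear_combination hroot
    have h3 : t ^ 2 - 5 = 0 := (mul_eq_zero.1 h2).resolve_left (by linarith)
    nlinarith
  · have h6' : (6 : ℝ) ≤ Fintype.card V := by exact_mod_cast h6
    -- Here κ = n - 3. The first inequality reads 3/2 ≤ (n-3)/2, which requires n ≥ 6.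
    refine lt_of_le_of_lt (h.eigenvalue_le_of_neighbors_pair_pair hww huv huw huw' hvw hvw' hu hv
      hx hx0 hA (p := 1 / 2) (r := 1) (by norm_num) (by norm_num) ?_ ?_ ?_) ht <;> linarith

/-- The positive root `t` bounds the eigenvalues with a nonnegative eigenvector, and only
the complete graph with a pendant negative triangle attains it. -/
theorem eq_root_of_le [DecidableEq V] (h : IsUnbalancedC4Free A) (hcard : 5 ≤ Fintype.card V)
    {x : V → ℝ} {μ t : ℝ} (hx : ∀ i, 0 ≤ x i)
    (hx0 : x ≠ 0) (hA : ∀ i, ∑ j, A i j * x j = μ * x i)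
    (ht : (Fintype.card V : ℝ) - 3 < t)
    (hroot : t * (t + 1) * (t - Fintype.card V + 4) =
      2 * (t - Fintype.card V + 4) + (Fintype.card V - 3) * (t + 1)) (hμ : t ≤ μ) :
    μ = t ∧ ∃ u v w, u ≠ v ∧ u ≠ w ∧ v ≠ w ∧
      ∀ i j, A i j = pendantTriangleMatrix u v w i j := by
  have hrows : ¬ ∀ j, ∑ i, A i j ≤ (Fintype.card V : ℝ) - 3 := by
    intro hrows
    refine hx0 (funext fun i => ?_)
    have := mul_eq_zero_of_subinvariant (y := fun _ => 1) hx (fun _ => zero_le_one) hA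
      (fun j => by simpa using hrows j) (ht.trans_le hμ) i
    simpa using this
  obtain ⟨u, v, a, b, huv, ha, hb⟩ := (h.exists_neg_edge (by omega)).resolve_left hrows
  have hvu : A v u = -1 := by rw [h.symm, huv]
  have hne : u ≠ v := by rintro rfl; rw [h.diag] at huv; norm_num at huv
  push Not at hrows
  obtain ⟨w, hw⟩ := hrows
  -- The large column sum at w leaves room for only one nonpositive entry off the diagonal.
  have key : ∀ i j, w ≠ i → w ≠ j → i ≠ j → A i w ≤ 0 → A j w ≤ 0 → False := by
    intro i j hi hj hij h1 h2
    refine absurd (sum_le_card_sub_three hi hj hij (fun k => h.le_one k w) ?_) (not_le.2 hw)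
    rw [h.diag]; linarith
  -- An entry -1, the diagonal 0 and any third entry add up to at most 0; hence w is neither u nor
  -- v.
  have hcol : ∀ j, (∃ i, A i j = -1) → ∑ i, A i j ≤ (Fintype.card V : ℝ) - 3 := by
    rintro j ⟨i, hi⟩
    have hij : i ≠ j := by rintro rfl; rw [h.diag] at hi; norm_num at hi
    obtain ⟨k, hk⟩ : ∃ k, k ∉ ({i, j} : Finset V) := by
      by_contra! hall
      have h1 : Finset.univ ⊆ ({i, j} : Finset V) := fun k _ => hall k
      have h2 := Finset.card_le_card h1
      have h3 : ({i, j} : Finset V).card ≤ 2 := Finset.card_le_two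
      rw [Finset.card_univ] at h2
      omega
    simp only [Finset.mem_insert, Finset.mem_singleton, not_or] at hk
    refine sum_le_card_sub_three hij (Ne.symm hk.1) (Ne.symm hk.2) (fun i => h.le_one i j) ?_
    rw [hi, h.diag]
    linarith [h.le_one k j]
  have hwu : w ≠ u := by
    rintro rfl
    exact absurd (hcol w ⟨v, hvu⟩) (not_le.2 hw)
  have hwv : w ≠ v := by
    rintro rfl
    exact absurd (hcol w ⟨u, huv⟩) (not_le.2 hw)
  have hav : a ≠ v := by rintro rfl; rw [huv] at ha; norm_num at ha
  have hbu : b ≠ u := by rintro rfl; rw [hvu] at hb; norm_num at hb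
  -- Otherwise w misses u together with v, or, if v is a positive neighbour of w, u together with
  -- the positive neighbour a of u.
  have huw : A u w = 1 := by
    by_contra huw
    by_cases hvw : A v w = 1
    · refine key u a hwu (by rintro rfl; exact huw ha) ?_ (h.nonpos_of_ne_one huw) ?_
      · rintro rfl; rw [h.diag] at ha; norm_num at ha
      · exact h.nonpos_of_neighbors huv ha hvw
    · exact key u v hwu hwv hne (h.nonpos_of_ne_one huw) (h.nonpos_of_ne_one hvw)
  have hvw : A v w = 1 := by
    by_contra hvw
    refine key v b hwv (by rintro rfl; exact hvw hb) ?_ (h.nonpos_of_ne_one hvw) ?_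
    · rintro rfl; rw [h.diag] at hb; norm_num at hb
    · exact h.nonpos_of_neighbors hvu hb huw
  have hnp : ∀ z, A u z = 1 ∨ A v z = 1 → A z w ≤ 0 := by
    rintro z (hz | hz)
    · exact h.nonpos_of_neighbors huv hz hvw
    · exact h.nonpos_of_neighbors hvu hz huw
  by_cases hex : ∃ w', w' ≠ w ∧ (A u w' = 1 ∨ A v w' = 1)
  · exfalso
    obtain ⟨w', hww, hw'⟩ := hex
    have hall : ∀ z, A u z = 1 ∨ A v z = 1 → z = w ∨ z = w' := by
      intro z hz
      by_contra! hc
      exact key z w' hc.1.symm hww.symm hc.2 (hnp z hz) (hnp w' hw')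
    have hlt := ht.trans_le hμ
    by_cases huw' : A u w' = 1 <;> by_cases hvw' : A v w' = 1
    · exact absurd hμ (not_le.2 (h.eigenvalue_le_root_of_neighbors_pair_pair hcard hww.symm huv
        huw huw' hvw hvw' (fun z hz => hall z (.inl hz)) (fun z hz => hall z (.inr hz)) hx hx0 hA
        ht hroot))
    · refine absurd hlt (not_lt.2 (h.eigenvalue_le_of_neighbors_pair_single hcard hww.symm huv
        huw huw' hvw (fun z hz => hall z (.inl hz)) (fun z hz => ?_) hx hx0 hA))
      refine (hall z (.inr hz)).resolve_right ?_
      rintro rfl; exact hvw' hz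
    · refine absurd hlt (not_lt.2 (h.eigenvalue_le_of_neighbors_pair_single hcard hww.symm hvu
        hvw hvw' huw (fun z hz => hall z (.inr hz)) (fun z hz => ?_) hx hx0 hA))
      refine (hall z (.inl hz)).resolve_right ?_
      rintro rfl; exact huw' hz
    · exact hw'.elim huw' hvw'
  · push Not at hex
    have hz : ∀ z, A u z = 1 ∨ A v z = 1 → z = w := by
      intro z hz
      by_contra hc
      exact hz.elim (hex z hc).1 (hex z hc).2
    obtain ⟨h1, h2⟩ := h.eq_pendantTriangleMatrix hcard hwv.symm hwu.symm huv
      (fun z hzu => hz z (.inl hzu)) (fun z hzv => hz z (.inr hzv)) hx hx0 hA ht hroot hμ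
    exact ⟨h1, u, v, w, hne, hwu.symm, hwv.symm, h2⟩

end IsUnbalancedC4Free

/-! ### Cycles, switching and isomorphism in terms of the adjacency matrix -/

namespace SignedGraph

variable {V W : Type*}

theorem adjMatrix_of_mem (Γ : SignedGraph V) {i j : V} (h : s(i, j) ∈ Γ.graph.edgeSet) :
    Γ.adjMatrix i j = ((Γ.sign ⟨s(i, j), h⟩ : ℤ) : ℝ) := by
  simp only [adjMatrix, Matrix.of_apply]
  rw [dif_pos h]

theorem adjMatrix_of_not_adj (Γ : SignedGraph V) {i j : V} (h : ¬ Γ.graph.Adj i j) :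
    Γ.adjMatrix i j = 0 := by
  simp only [adjMatrix, Matrix.of_apply]
  exact dif_neg h

theorem adjMatrix_symm (Γ : SignedGraph V) (i j : V) : Γ.adjMatrix i j = Γ.adjMatrix j i := by
  simpa using (Γ.adjMatrix_isHermitian.apply i j).symm

theorem adjMatrix_diag (Γ : SignedGraph V) (i : V) : Γ.adjMatrix i i = 0 :=
  Γ.adjMatrix_of_not_adj (Γ.graph.irrefl)

theorem adjMatrix_entry (Γ : SignedGraph V) (i j : V) :
    Γ.adjMatrix i j = -1 ∨ Γ.adjMatrix i j = 0 ∨ Γ.adjMatrix i j = 1 := by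
  by_cases h : Γ.graph.Adj i j
  · rw [Γ.adjMatrix_of_mem h]
    rcases Int.units_eq_one_or (Γ.sign ⟨s(i, j), h⟩) with h | h <;> rw [h] <;> simp
  · exact .inr (.inl (Γ.adjMatrix_of_not_adj h))

theorem adj_iff_adjMatrix_ne_zero (Γ : SignedGraph V) {i j : V} :
    Γ.graph.Adj i j ↔ Γ.adjMatrix i j ≠ 0 := by
  refine ⟨fun h => ?_, fun h => by_contra fun hn => h (Γ.adjMatrix_of_not_adj hn)⟩
  rw [Γ.adjMatrix_of_mem h]
  simp

theorem isNegEdge_iff (Γ : SignedGraph V) {i j : V} :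
    Γ.IsNegEdge s(i, j) ↔ Γ.adjMatrix i j = -1 := by
  constructor
  · rintro ⟨h, hs⟩
    rw [Γ.adjMatrix_of_mem h, hs]
    simp
  · intro h
    have hadj : Γ.graph.Adj i j := Γ.adj_iff_adjMatrix_ne_zero.2 (by rw [h]; norm_num)
    refine ⟨hadj, ?_⟩
    rw [Γ.adjMatrix_of_mem hadj] at h
    rcases Int.units_eq_one_or (Γ.sign ⟨s(i, j), hadj⟩) with h' | h'
    · rw [h'] at h; norm_num at h
    · exact h'

theorem neg_one_pow_negCount_nil (Γ : SignedGraph V) (u : V) :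
    (-1 : ℝ) ^ Γ.negCount (SimpleGraph.Walk.nil : Γ.graph.Walk u u) = 1 := by
  simp [negCount]

theorem neg_one_pow_negCount_cons (Γ : SignedGraph V) {u v w : V} (h : Γ.graph.Adj u v)
    (p : Γ.graph.Walk v w) :
    (-1 : ℝ) ^ Γ.negCount (SimpleGraph.Walk.cons h p) =
      Γ.adjMatrix u v * (-1) ^ Γ.negCount p := by
  simp only [negCount, SimpleGraph.Walk.edges_cons, List.countP_cons]
  by_cases hn : Γ.IsNegEdge s(u, v)
  · rw [Γ.isNegEdge_iff.1 hn]
    simp [hn, pow_succ]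
  · have h1 : Γ.adjMatrix u v = 1 := by
      rcases Γ.adjMatrix_entry u v with h' | h' | h'
      · exact absurd (Γ.isNegEdge_iff.2 h') hn
      · exact absurd h' (Γ.adj_iff_adjMatrix_ne_zero.1 h)
      · exact h'
    rw [h1]
    simp [hn]

theorem odd_negCount_iff (Γ : SignedGraph V) {u v : V} (p : Γ.graph.Walk u v) :
    Odd (Γ.negCount p) ↔ (-1 : ℝ) ^ Γ.negCount p = -1 := by
  constructor
  · exact fun h => h.neg_one_pow
  · intro h
    by_contra hn
    rw [Nat.not_odd_iff_even] at hn
    rw [hn.neg_one_pow] at h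
    norm_num at h

/-- Each edge sign equals the product of ε at its ends, so the sign of a walk telescopes to the
product of ε at its two end vertices, which is 1 for a closed walk. -/
theorem isBalanced_of_forall_nonneg (Γ : SignedGraph V) (ε : V → ℝ)
    (hε : ∀ i, ε i = 1 ∨ ε i = -1) (h : ∀ i j, 0 ≤ ε i * Γ.adjMatrix i j * ε j) :
    Γ.IsBalanced := by
  have hsq : ∀ i, ε i * ε i = 1 := by
    intro i; rcases hε i with h | h <;> rw [h] <;> norm_num
  have key : ∀ {u v : V} (p : Γ.graph.Walk u v), (-1 : ℝ) ^ Γ.negCount p = ε u * ε v := by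
    intro u v p
    induction p with
    | nil => rw [Γ.neg_one_pow_negCount_nil, hsq]
    | @cons u v w hadj p ih =>
      rw [Γ.neg_one_pow_negCount_cons, ih]
      have h0 := h u v
      have h1 : Γ.adjMatrix u v = ε u * ε v := by
        rcases Γ.adjMatrix_entry u v with h' | h' | h'
        · rw [h'] at h0 ⊢
          rcases hε u with hu | hu <;> rcases hε v with hv | hv <;> rw [hu, hv] at h0 ⊢ <;>
            norm_num at h0 <;> norm_num
        · exact absurd h' (Γ.adj_iff_adjMatrix_ne_zero.1 hadj)
        · rw [h'] at h0 ⊢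
          rcases hε u with hu | hu <;> rcases hε v with hv | hv <;> rw [hu, hv] at h0 ⊢ <;>
            norm_num at h0 <;> norm_num
      rw [h1]
      linear_combination ε u * ε w * hsq v
  intro u p _
  by_contra hn
  rw [Nat.not_even_iff_odd, odd_negCount_iff, key, hsq] at hn
  norm_num at hn

theorem four_cycle_nonneg (Γ : SignedGraph V) (h : ¬ Γ.HasNegCycle 4) {a b c d : V}
    (hac : a ≠ c) (hbd : b ≠ d) :
    0 ≤ Γ.adjMatrix a b * Γ.adjMatrix b c * Γ.adjMatrix c d * Γ.adjMatrix d a := by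
  by_contra! hneg
  have hab : Γ.graph.Adj a b := Γ.adj_iff_adjMatrix_ne_zero.2 fun h => by simp [h] at hneg
  have hbc : Γ.graph.Adj b c := Γ.adj_iff_adjMatrix_ne_zero.2 fun h => by simp [h] at hneg
  have hcd : Γ.graph.Adj c d := Γ.adj_iff_adjMatrix_ne_zero.2 fun h => by simp [h] at hneg
  have hda : Γ.graph.Adj d a := Γ.adj_iff_adjMatrix_ne_zero.2 fun h => by simp [h] at hneg
  refine h ⟨a, .cons hab (.cons hbc (.cons hcd (.cons hda .nil))), ?_, rfl, ?_⟩
  · simp [SimpleGraph.Walk.isCycle_def, SimpleGraph.Walk.isTrail_def, hac, hac.symm, hbd, hab.ne,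
      hbc.ne, hcd.ne, hda.ne, hab.ne.symm, hda.ne.symm]
  · rw [odd_negCount_iff]
    simp only [neg_one_pow_negCount_cons, neg_one_pow_negCount_nil, mul_one]
    rcases Γ.adjMatrix_entry a b with h1 | h1 | h1 <;>
    rcases Γ.adjMatrix_entry b c with h2 | h2 | h2 <;>
    rcases Γ.adjMatrix_entry c d with h3 | h3 | h3 <;>
    rcases Γ.adjMatrix_entry d a with h4 | h4 | h4 <;>
    rw [h1, h2, h3, h4] at hneg ⊢ <;> norm_num at hneg <;> norm_num

theorem exists_of_hasNegCycle_four (Γ : SignedGraph V) (h : Γ.HasNegCycle 4) :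
    ∃ a b c d, a ≠ c ∧ b ≠ d ∧
      Γ.adjMatrix a b * (Γ.adjMatrix b c * (Γ.adjMatrix c d * Γ.adjMatrix d a)) = -1 := by
  obtain ⟨a, p, hp, hl, hodd⟩ := h
  rw [odd_negCount_iff] at hodd
  match p, hp, hl, hodd with
  | .cons (v := b) hab (.cons (v := c) hbc (.cons (v := d) hcd (.cons hda .nil))), hp, _, hodd =>
    simp only [neg_one_pow_negCount_cons, neg_one_pow_negCount_nil, mul_one] at hodd
    refine ⟨a, b, c, d, ?_, ?_, hodd⟩
    · rintro rfl
      simp [SimpleGraph.Walk.isCycle_def] at hp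
    · rintro rfl
      simp [SimpleGraph.Walk.isCycle_def] at hp

open Classical in
theorem switch_adjMatrix (Γ : SignedGraph V) (U : Set V) (i j : V) :
    (Γ.switch U).adjMatrix i j =
      (if i ∈ U then -1 else 1) * Γ.adjMatrix i j * (if j ∈ U then -1 else 1) := by
  by_cases h : Γ.graph.Adj i j
  · rw [Γ.adjMatrix_of_mem h, (Γ.switch U).adjMatrix_of_mem (i := i) (j := j) h]
    have hc : Crosses U s(i, j) ↔ (i ∈ U ∧ j ∉ U) ∨ (j ∈ U ∧ i ∉ U) := by
      constructor
      · rintro ⟨u, hu, v, hv, he⟩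
        rcases Sym2.eq_iff.1 he with ⟨rfl, rfl⟩ | ⟨rfl, rfl⟩
        · exact .inl ⟨hu, hv⟩
        · exact .inr ⟨hu, hv⟩
      · rintro (⟨h1, h2⟩ | ⟨h1, h2⟩)
        · exact ⟨i, h1, j, h2, rfl⟩
        · exact ⟨j, h1, i, h2, Sym2.eq_swap⟩
    simp only [switch, hc]
    by_cases hi : i ∈ U <;> by_cases hj : j ∈ U <;> simp [hi, hj]
  · rw [Γ.adjMatrix_of_not_adj h, (Γ.switch U).adjMatrix_of_not_adj (i := i) (j := j) h]
    simp

theorem isomorphic_of_adjMatrix (Γ : SignedGraph V) (Δ : SignedGraph W) (f : V ≃ W)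
    (h : ∀ i j, Δ.adjMatrix (f i) (f j) = Γ.adjMatrix i j) : Γ.Isomorphic Δ := by
  refine ⟨⟨f, fun {i j} => ?_⟩, fun u v hu hv => ?_⟩
  · rw [Γ.adj_iff_adjMatrix_ne_zero, Δ.adj_iff_adjMatrix_ne_zero, h]
  · have h1 := h u v
    rw [Γ.adjMatrix_of_mem hu] at h1
    have h2 := (Δ.adjMatrix_of_mem (i := f u) (j := f v) hv).symm.trans h1
    exact Units.ext (Int.cast_injective (α := ℝ) h2)

theorem Isomorphic.exists_adjMatrix {Γ : SignedGraph V} {Δ : SignedGraph W}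
    (h : Γ.Isomorphic Δ) : ∃ f : V ≃ W, ∀ i j, Δ.adjMatrix (f i) (f j) = Γ.adjMatrix i j := by
  obtain ⟨f, hf⟩ := h
  refine ⟨f.toEquiv, fun i j => ?_⟩
  by_cases hij : Γ.graph.Adj i j
  · have hij' : Δ.graph.Adj (f i) (f j) := f.map_rel_iff.2 hij
    rw [Γ.adjMatrix_of_mem hij, ← hf i j hij hij']
    exact Δ.adjMatrix_of_mem hij'
  · rw [Γ.adjMatrix_of_not_adj hij]
    exact Δ.adjMatrix_of_not_adj fun h => hij (f.map_rel_iff.1 h)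

/-! ### Invariance of the index -/

section Index

variable [Fintype V] [Fintype W]

theorem exists_eigenvector_index [Nonempty V] (Γ : SignedGraph V) :
    ∃ x : V → ℝ, x ≠ 0 ∧ ∀ i, ∑ j, Γ.adjMatrix i j * x j = Γ.index * x i := by
  classical
  obtain ⟨x, hx⟩ := Γ.index_isGreatest.1.exists_hasEigenvector
  refine ⟨x, hx.2, fun i => ?_⟩
  have := congrFun hx.apply_eq_smul i
  simpa [Matrix.toLin'_apply, Matrix.mulVec, dotProduct] using this

theorem le_index_of_eigenvector [Nonempty V] (Γ : SignedGraph V) {x : V → ℝ} {μ : ℝ}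
    (hx : x ≠ 0) (h : ∀ i, ∑ j, Γ.adjMatrix i j * x j = μ * x i) : μ ≤ Γ.index := by
  classical
  refine Γ.index_isGreatest.2 (Module.End.hasEigenvalue_of_hasEigenvector (x := x) ⟨?_, hx⟩)
  rw [Module.End.mem_eigenspace_iff]
  ext i
  simpa [Matrix.toLin'_apply, Matrix.mulVec, dotProduct] using h i

/-- Pulling an eigenvector of Δ back along f and multiplying it by ε gives an eigenvector of Γ for
the same eigenvalue. -/
theorem index_le_of_adjMatrix [Nonempty V] [Nonempty W] (Γ : SignedGraph V) (Δ : SignedGraph W)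
    (f : V ≃ W) (ε : V → ℝ) (hε : ∀ i, ε i * ε i = 1)
    (h : ∀ i j, Δ.adjMatrix (f i) (f j) = ε i * Γ.adjMatrix i j * ε j) :
    Δ.index ≤ Γ.index := by
  obtain ⟨x, hx0, hx⟩ := Δ.exists_eigenvector_index
  refine Γ.le_index_of_eigenvector (x := fun i => ε i * x (f i)) (fun h0 => hx0 ?_) fun i => ?_
  · funext k
    have h1 := congrFun h0 (f.symm k)
    simp only [Equiv.apply_symm_apply, Pi.zero_apply] at h1
    have h2 := hε (f.symm k)
    have h3 : ε (f.symm k) ≠ 0 := by rintro h; rw [h] at h2; norm_num at h2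
    exact (mul_eq_zero.1 h1).resolve_left h3
  · have h1 := hx (f i)
    rw [← Equiv.sum_comp f] at h1
    calc ∑ j, Γ.adjMatrix i j * (ε j * x (f j))
        = ε i * ∑ j, Δ.adjMatrix (f i) (f j) * x (f j) := by
          rw [Finset.mul_sum]
          refine Finset.sum_congr rfl fun j _ => ?_
          rw [h]
          linear_combination -(Γ.adjMatrix i j * ε j * x (f j)) * hε i
      _ = Δ.index * (ε i * x (f i)) := by rw [h1]; ring

theorem index_eq_of_adjMatrix [Nonempty V] [Nonempty W] (Γ : SignedGraph V) (Δ : SignedGraph W)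
    (f : V ≃ W) (ε : V → ℝ) (hε : ∀ i, ε i * ε i = 1)
    (h : ∀ i j, Δ.adjMatrix (f i) (f j) = ε i * Γ.adjMatrix i j * ε j) :
    Δ.index = Γ.index := by
  refine le_antisymm (index_le_of_adjMatrix Γ Δ f ε hε h)
    (index_le_of_adjMatrix Δ Γ f.symm (fun k => ε (f.symm k)) (fun k => hε _) fun k l => ?_)
  have h1 := h (f.symm k) (f.symm l)
  simp only [Equiv.apply_symm_apply] at h1
  rw [h1]
  have h2 := hε (f.symm k)
  have h3 := hε (f.symm l)
  linear_combination (-(Γ.adjMatrix (f.symm k) (f.symm l))) * h2 -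
    (Γ.adjMatrix (f.symm k) (f.symm l)) * ε (f.symm k) * ε (f.symm k) * h3

theorem index_switch [Nonempty V] (Γ : SignedGraph V) (U : Set V) :
    (Γ.switch U).index = Γ.index := by
  classical
  exact index_eq_of_adjMatrix Γ (Γ.switch U) (Equiv.refl V) (fun i => if i ∈ U then -1 else 1)
    (fun i => by split_ifs <;> norm_num) fun i j => Γ.switch_adjMatrix U i j

theorem SwitchingIsomorphic.index_eq [Nonempty V] [Nonempty W] {Γ : SignedGraph V}
    {Δ : SignedGraph W} (h : Γ.SwitchingIsomorphic Δ) : Γ.index = Δ.index := by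
  obtain ⟨Γ', hs, hi⟩ := h
  obtain ⟨f, hf⟩ := hi.exists_adjMatrix
  rw [index_eq_of_adjMatrix Γ' Δ f (fun _ => 1) (fun _ => by norm_num)
    fun i j => by rw [hf]; ring]
  clear hi f hf
  induction hs with
  | refl => rfl
  | tail _ hstep ih =>
    obtain ⟨U, rfl⟩ := hstep
    rw [ih, index_switch]

end Index

/-! ### The signed graph Γ₁ -/

theorem gammaOne_adjMatrix (n : ℕ) (u v w : Fin n) (hu : u.val = 0) (hv : v.val = 1)
    (hw : w.val = 2) (i j : Fin n) :
    (gammaOne n).adjMatrix i j = pendantTriangleMatrix u v w i j := by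
  have hiu : i = u ↔ i.val = 0 := by rw [Fin.ext_iff, hu]
  have hiv : i = v ↔ i.val = 1 := by rw [Fin.ext_iff, hv]
  have hiw : i = w ↔ i.val = 2 := by rw [Fin.ext_iff, hw]
  have hju : j = u ↔ j.val = 0 := by rw [Fin.ext_iff, hu]
  have hjv : j = v ↔ j.val = 1 := by rw [Fin.ext_iff, hv]
  have hjw : j = w ↔ j.val = 2 := by rw [Fin.ext_iff, hw]
  unfold pendantTriangleMatrix
  simp only [hiu, hiv, hiw, hju, hjv, hjw, Fin.ext_iff]
  by_cases h : (gammaOne n).graph.Adj i j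
  · have h' := h
    simp only [gammaOne, ne_eq, Fin.ext_iff] at h'
    rw [(gammaOne n).adjMatrix_of_mem h]
    simp only [gammaOne, Sym2.mem_iff, forall_eq_or_imp, forall_eq]
    by_cases hc : i.val ≤ 1 ∧ j.val ≤ 1
    · rw [if_pos hc, if_neg h'.1, if_pos (by omega)]
      simp
    · rw [if_neg hc, if_neg h'.1, if_neg (by omega)]
      split_ifs
      · simp
      · omega
      · simp
  · rw [(gammaOne n).adjMatrix_of_not_adj h]
    simp only [gammaOne, ne_eq, Fin.ext_iff] at h
    split_ifs <;> first | rfl | omega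

theorem gammaOne_not_isBalanced (n : ℕ) (hn : 5 ≤ n) : ¬ (gammaOne n).IsBalanced := by
  intro h
  let u : Fin n := ⟨0, by omega⟩
  let v : Fin n := ⟨1, by omega⟩
  let w : Fin n := ⟨2, by omega⟩
  have huv : u ≠ v := by simp [u, v]
  have huw : u ≠ w := by simp [u, w]
  have hvw : v ≠ w := by simp [v, w]
  have auv : (gammaOne n).graph.Adj u v := ⟨huv, .inr ⟨by simp [u], by simp [v]⟩⟩
  have avw : (gammaOne n).graph.Adj v w := ⟨hvw, .inr ⟨by simp [v], by simp [w]⟩⟩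
  have awu : (gammaOne n).graph.Adj w u := ⟨huw.symm, .inr ⟨by simp [w], by simp [u]⟩⟩
  have hodd := h u (.cons auv (.cons avw (.cons awu .nil))) (by
    simp [SimpleGraph.Walk.isCycle_def, SimpleGraph.Walk.isTrail_def, huv, huw, hvw, huv.symm,
      huw.symm])
  rw [← Nat.not_odd_iff_even, odd_negCount_iff] at hodd
  refine hodd ?_
  simp only [neg_one_pow_negCount_cons, neg_one_pow_negCount_nil, mul_one,
    gammaOne_adjMatrix n u v w rfl rfl rfl]
  simp [pendantTriangleMatrix, huv, huw, hvw, huw.symm, hvw.symm]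

theorem gammaOne_not_hasNegCycle_four (n : ℕ) (hn : 5 ≤ n) : ¬ (gammaOne n).HasNegCycle 4 := by
  intro h
  obtain ⟨a, b, c, d, hac, hbd, hprod⟩ := exists_of_hasNegCycle_four _ h
  have hadj : ∀ i j, (gammaOne n).adjMatrix i j ≠ 0 →
      i.val ≠ j.val ∧ ((2 ≤ i.val ∧ 2 ≤ j.val) ∨ (i.val ≤ 2 ∧ j.val ≤ 2)) := by
    intro i j hij
    have := (adj_iff_adjMatrix_ne_zero _).2 hij
    simpa only [gammaOne, ne_eq, Fin.ext_iff] using this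
  have hab := hadj a b fun h => by simp [h] at hprod
  have hbc := hadj b c fun h => by simp [h] at hprod
  have hcd := hadj c d fun h => by simp [h] at hprod
  have hda := hadj d a fun h => by simp [h] at hprod
  have hac' : a.val ≠ c.val := fun h => hac (Fin.ext h)
  have hbd' : b.val ≠ d.val := fun h => hbd (Fin.ext h)
  have hone : ∀ i j : Fin n, i.val ≠ j.val → 2 ≤ i.val → 2 ≤ j.val →
      (gammaOne n).adjMatrix i j = 1 := by
    intro i j hij hi hj
    rw [gammaOne_adjMatrix n ⟨0, by omega⟩ ⟨1, by omega⟩ ⟨2, by omega⟩ rfl rfl rfl]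
    simp only [pendantTriangleMatrix, Fin.ext_iff]
    rw [if_neg hij, if_neg (by omega)]
    split_ifs <;> first | rfl | omega
  -- The vertices 0 and 1 lie on no 4-cycle, since their only neighbours are each other and 2. All
  -- four vertices are thus in the clique, where every edge is positive.
  rw [hone a b hab.1 (by omega) (by omega), hone b c hbc.1 (by omega) (by omega),
    hone c d hcd.1 (by omega) (by omega), hone d a hda.1 (by omega) (by omega)] at hprod
  norm_num at hprod

/-- Only this inequality is proved directly. That the index equals t is never needed, because graphs
of index at least t are shown to have index exactly t. -/
theorem root_le_gammaOne_index (n : ℕ) (hn : 5 ≤ n) {t : ℝ} (ht : (n : ℝ) - 3 < t)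
    (hroot : t * (t + 1) * (t - n + 4) = 2 * (t - n + 4) + (n - 3) * (t + 1)) :
    t ≤ (gammaOne n).index := by
  have : Nonempty (Fin n) := ⟨⟨0, by omega⟩⟩
  let u : Fin n := ⟨0, by omega⟩
  let v : Fin n := ⟨1, by omega⟩
  let w : Fin n := ⟨2, by omega⟩
  have hvw : v ≠ w := by simp [v, w]
  have huw : u ≠ w := by simp [u, w]
  refine (gammaOne n).le_index_of_eigenvector (x := pendantTriangleVec u v w t) ?_ fun i => ?_
  · intro h
    have := congrFun h w
    simp [pendantTriangleVec, hvw.symm, huw.symm] at this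
  · rw [← sum_pendantTriangle (by simp [u, v]) huw hvw (by simpa using hn) (by simpa using ht)
      (by simpa using hroot) i]
    refine Finset.sum_congr rfl fun j _ => ?_
    rw [adjMatrix_symm, gammaOne_adjMatrix n u v w rfl rfl rfl, mul_comm]

/-! ### The extremal graphs -/

/-- A bijection with `Fin n` which maps three given vertices to `0`, `1` and `2`. -/
theorem exists_equiv_fin [Fintype V] {n : ℕ} (hcard : Fintype.card V = n) {u v w : V}
    (huv : u ≠ v) (huw : u ≠ w) (hvw : v ≠ w) :
    ∃ f : V ≃ Fin n, (f u).val = 0 ∧ (f v).val = 1 ∧ (f w).val = 2 := by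
  classical
  have h3 : 3 ≤ n := by
    rw [← hcard, ← Finset.card_eq_three.2 ⟨u, v, w, huv, huw, hvw, rfl⟩]
    exact Finset.card_le_univ _
  let e : V ≃ Fin n := Fintype.equivFinOfCardEq hcard
  have hinj : Function.Injective (fun i : Fin 3 => e (![u, v, w] i)) := by
    refine e.injective.comp fun i j hij => ?_
    fin_cases i <;> fin_cases j <;> simp_all
  obtain ⟨σ, hσ⟩ := Equiv.Perm.exists_extending_pair _ _ hinj (Fin.castLE_injective h3)
  exact ⟨e.trans σ, congrArg Fin.val (hσ 0), congrArg Fin.val (hσ 1), congrArg Fin.val (hσ 2)⟩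

/-- An unbalanced signed graph without negative `4`-cycles whose index is at least the one of
`gammaOne n` has the same index and is switching equivalent to `gammaOne n`. -/
theorem switchingIsomorphic_gammaOne [Fintype V] {n : ℕ} (hn : 5 ≤ n) (Γ : SignedGraph V)
    (hcard : Fintype.card V = n) (hunb : ¬ Γ.IsBalanced) (hC4 : ¬ Γ.HasNegCycle 4) {t : ℝ}
    (ht : (n : ℝ) - 3 < t)
    (hroot : t * (t + 1) * (t - n + 4) = 2 * (t - n + 4) + (n - 3) * (t + 1))
    (hle : t ≤ Γ.index) :
    Γ.index = t ∧ Γ.SwitchingIsomorphic (gammaOne n) := by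
  classical
  have : Nonempty V := Fintype.card_pos_iff.1 (by omega)
  obtain ⟨x, hx0, hx⟩ := Γ.exists_eigenvector_index
  -- Switching at the negative coordinates of x replaces x by |x|; vertices with coordinate 0 are
  -- not switched.
  let ε : V → ℝ := fun i => if i ∈ {i | x i < 0} then -1 else 1
  have hε : ∀ i, ε i = 1 ∨ ε i = -1 := fun i => by simp only [ε]; split_ifs <;> simp
  have hεsq : ∀ i, ε i * ε i = 1 := by
    intro i; rcases hε i with h | h <;> rw [h] <;> norm_num
  have hεx : ∀ i, ε i * x i = |x i| := by
    intro i
    simp only [ε, Set.mem_ofPred_eq]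
    split_ifs with h
    · rw [abs_of_neg h]; ring
    · rw [abs_of_nonneg (not_lt.1 h), one_mul]
  have hB : ∀ i j, (Γ.switch {i | x i < 0}).adjMatrix i j = ε i * Γ.adjMatrix i j * ε j :=
    Γ.switch_adjMatrix _
  set Γ' := Γ.switch {i | x i < 0} with hΓ'
  have hU : IsUnbalancedC4Free Γ'.adjMatrix := by
    refine ⟨Γ'.adjMatrix_entry, Γ'.adjMatrix_symm, Γ'.adjMatrix_diag, ?_, ?_⟩
    · intro a b c d hac hbd
      rw [hB, hB, hB, hB]
      have := Γ.four_cycle_nonneg hC4 hac hbd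
      calc (0 : ℝ) ≤ _ := this
        _ = (ε a * ε a) * (ε b * ε b) * (ε c * ε c) * (ε d * ε d) *
          (Γ.adjMatrix a b * Γ.adjMatrix b c * Γ.adjMatrix c d * Γ.adjMatrix d a) := by
            simp only [hεsq, one_mul]
        _ = _ := by ring
    · intro δ hδ
      by_contra! hno
      -- A sign vector δ that makes the switched matrix nonnegative combines with ε into one that
      -- makes the matrix of Γ nonnegative.
      refine hunb (Γ.isBalanced_of_forall_nonneg (fun i => δ i * ε i) (fun i => ?_)
        fun i j => ?_)
      · rcases hδ i with h1 | h1 <;> rcases hε i with h2 | h2 <;> simp [h1, h2]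
      · have := hno i j
        rw [hB] at this
        linarith
  have hA : ∀ i, ∑ j, Γ'.adjMatrix i j * |x j| = Γ.index * |x i| := by
    intro i
    rw [← hεx i, show Γ.index * (ε i * x i) = ε i * (Γ.index * x i) by ring, ← hx i,
      Finset.mul_sum]
    refine Finset.sum_congr rfl fun j _ => ?_
    rw [← hεx j, hB]
    linear_combination (ε i * Γ.adjMatrix i j * x j) * hεsq j
  obtain ⟨h1, u, v, w, huv, huw, hvw, hM⟩ := hU.eq_root_of_le (by omega) (fun i => abs_nonneg (x i))
    (fun h => hx0 (funext fun i => abs_eq_zero.1 (congrFun h i))) hA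
    (by rw [hcard]; exact ht) (by rw [hcard]; exact hroot) hle
  refine ⟨h1, Γ', .single ⟨_, hΓ'⟩, ?_⟩
  obtain ⟨f, hfu, hfv, hfw⟩ := exists_equiv_fin hcard huv huw hvw
  refine isomorphic_of_adjMatrix Γ' (gammaOne n) f fun i j => ?_
  rw [hM, gammaOne_adjMatrix n (f u) (f v) (f w) hfu hfv hfw]
  simp only [pendantTriangleMatrix, f.injective.eq_iff]

end SignedGraph

theorem theorem1p1 (n : ℕ) (hn : 5 ≤ n) :
    -- an unbalanced signed graph of index at least that of `Γ₁` contains a negative 4-cycle,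
    -- unless it is switching equivalent to `Γ₁`
    (∀ (V : Type*) [Fintype V] (Γ : SignedGraph V), Fintype.card V = n →
      ¬ Γ.IsBalanced → (SignedGraph.gammaOne n).index ≤ Γ.index →
      ¬ Γ.SwitchingIsomorphic (SignedGraph.gammaOne n) → Γ.HasNegCycle 4) ∧
    -- `Γ₁` is itself unbalanced without negative 4-cycles
    ¬ (SignedGraph.gammaOne n).IsBalanced ∧
    ¬ (SignedGraph.gammaOne n).HasNegCycle 4 ∧
    -- and it is the unique maximizer of the index among such signed graphs of order `n`
    (∀ (V : Type*) [Fintype V] (Γ : SignedGraph V), Fintype.card V = n →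
      ¬ Γ.IsBalanced → ¬ Γ.HasNegCycle 4 →
      Γ.index ≤ (SignedGraph.gammaOne n).index ∧
        (Γ.index = (SignedGraph.gammaOne n).index ↔
          Γ.SwitchingIsomorphic (SignedGraph.gammaOne n))) := by
  obtain ⟨t, ht, hroot⟩ := exists_pendantTriangle_root n hn
  have hidx := SignedGraph.root_le_gammaOne_index n hn ht hroot
  refine ⟨fun V _ Γ hcard hunb hle hniso => ?_, SignedGraph.gammaOne_not_isBalanced n hn,
    SignedGraph.gammaOne_not_hasNegCycle_four n hn, fun V _ Γ hcard hunb hC4 => ⟨?_, ?_, ?_⟩⟩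
  · by_contra hC4
    exact hniso (Γ.switchingIsomorphic_gammaOne hn hcard hunb hC4 ht hroot (hidx.trans hle)).2
  · rcases le_total t Γ.index with h | h
    · rw [(Γ.switchingIsomorphic_gammaOne hn hcard hunb hC4 ht hroot h).1]
      exact hidx
    · exact h.trans hidx
  · intro h
    exact (Γ.switchingIsomorphic_gammaOne hn hcard hunb hC4 ht hroot (h ▸ hidx)).2
  · intro h
    have : Nonempty V := Fintype.card_pos_iff.1 (by omega)
    have : Nonempty (Fin n) := ⟨⟨0, by omega⟩⟩
    exact h.index_eq
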